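/- **Lemma 2.1.** Let $(\mathcal X_t)_{t\in\mathbb N}$ and $(\mathcal Y_t)_{t\in\mathbb N}$ be sequences of Polish spaces with their Borel $\sigma$-algebras, and let $X_t:\Omega\to\mathcal X_t$ and $Y_t:\Omega\to\mathcal Y_t$, $t\in\mathbb N=\{0,1,2,\dots\}$, be random variables on a probability space $(\Omega,\mathcal F,\mathbb P)$. Write $X^i=(X_0,\dots,X_i)$, $Y^i=(Y_0,\dots,Y_i)$, with $X^{-1},Y^{-1}$ trivial (constant). Fix $n\in\mathbb N$, let $\mu_{0,n}$ be a probability measure on $\mathcal X_0\times\dots\times\mathcal X_n$ and $q_{0,n}(dy^n;x^n)$ a stochastic kernel from $\mathcal X_0\times\dots\times\mathcal X_n$ to $\mathcal Y_0\times\dots\times\mathcal Y_n$ such that $(X^n,Y^n)$ has the law $\mu_{0,n}(dx^n)\,q_{0,n}(dy^n;x^n)$. Let $D(\cdot\|\cdot)$ be the relative entropy, and let $$I(U;W)=D(P_{U,W}\,\|\,P_U\times P_W),\qquad I(U;W|V)=D\big(P_{V,U,W}\,\big\|\,P_V\otimes(P_{U|V}\times P_{W|V})\big)$$ be the mutual and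 the conditional mutual information, with values in $[0,\infty]$. Put $$I(X^n\to Y^n)=\sum_{i=0}^n I(X^i;Y_i|Y^{i-1}),\qquad I(X^n\leftarrow Y^n)=\sum_{i=0}^n I(Y^{i-1};X_i|X^{i-1}).$$ We say that $U\leftrightarrow V\leftrightarrow W$ is a Markov chain if $U$ and $W$ are conditionally independent given $V$. Consider the following statements. 1. There are stochastic kernels $q_i(dy_i;y^{i-1},x^i)$ from $\mathcal Y_0\times\dots\times\mathcal Y_{i-1}\times\mathcal X_0\times\dots\times\mathcal X_i$ to $\mathcal Y_i$, $i=0,\dots,n$, such that $q_{0,n}(dy^n;x^n)=\bigotimes_{i=0}^n q_i(dy_i;y^{i-1},x^i)$ for $\mu_{0,n}$-almost every $x^n$. 2. For each $i=0,\dots,n-1$, $Y_i\leftrightarrow(X^i,Y^{i-1})\leftrightarrow(X_{i+1},\dots,X_n)$ is a Markov chain. 3. $I(X^n;Y^n)=I(X^n\to Y^n)$. 4. $I(X^n\leftarrow Y^n)=0$. 5. For each $i=0,\dots,n-1$, $Y^i\leftrightarrow X^i\leftrightarrow X_{i+1}$ is a Markov chain. Then (1), (2), (4) and (5) are equivalent,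 and they imply (3). If $I(X^n\to Y^n)<\infty$, then all five statements are equivalent. -/

import Mathlib

open MeasureTheory ProbabilityTheory InformationTheory
open scoped ENNReal

namespace CausalRD

noncomputable section

/-- `Path 𝒵 m` is the product of the first `m` alphabets `𝒵 0, …, 𝒵 (m - 1)`; the strings
`z^i = (z_0, …, z_i)` are the elements of `Path 𝒵 (i + 1)`. `Path 𝒵 0` is a one-point space
(the range of `z^{-1}`). -/
abbrev Path (𝒵 : ℕ → Type*) (m : ℕ) := (j : Fin m) → 𝒵 j

variable {Ω : Type*}

/-- The first `m` variables of a process: `Z^{m-1} = (Z_0, …, Z_{m-1})`. -/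
def path {𝒵 : ℕ → Type*} (Z : (t : ℕ) → Ω → 𝒵 t) (m : ℕ) (ω : Ω) : Path 𝒵 m :=
  fun j => Z j ω

/-- The block `(Z_{i+1}, …, Z_n)`. -/
def future {𝒵 : ℕ → Type*} (Z : (t : ℕ) → Ω → 𝒵 t) (i n : ℕ) (ω : Ω) :
    (j : Finset.Ioc i n) → 𝒵 j :=
  fun j => Z j ω

/-- `U ↔ V ↔ W` is a Markov chain: `U` and `W` are conditionally independent given `V`,
that is `P(U ∈ A, W ∈ B | V) = P(U ∈ A | V) P(W ∈ B | V)` almost surely, for all measurable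
`A` and `B`. -/
def IsMarkovChain [MeasurableSpace Ω] {α β γ : Type*} [MeasurableSpace α] [mβ : MeasurableSpace β]
    [MeasurableSpace γ] (U : Ω → α) (V : Ω → β) (W : Ω → γ) (P : Measure Ω) : Prop :=
  ∀ (A : Set α) (B : Set γ), MeasurableSet A → MeasurableSet B →
    P⟦U ⁻¹' A ∩ W ⁻¹' B | mβ.comap V⟧ =ᵐ[P]
      fun ω => (P⟦U ⁻¹' A | mβ.comap V⟧) ω * (P⟦W ⁻¹' B | mβ.comap V⟧) ω

/-- Mutual information `I(U ; W) = D(P_{U,W} ‖ P_U × P_W)`, in `[0, ∞]`. -/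
def mutualInfo [MeasurableSpace Ω] {α γ : Type*} [MeasurableSpace α] [MeasurableSpace γ]
    (U : Ω → α) (W : Ω → γ) (P : Measure Ω) : ℝ≥0∞ :=
  klDiv (P.map fun ω => (U ω, W ω)) ((P.map U).prod (P.map W))

/-- Conditional mutual information
`I(U ; W | V) = D(P_{V,U,W} ‖ P_V ⊗ (P_{U|V} × P_{W|V}))`, in `[0, ∞]`. -/
def condMutualInfo [MeasurableSpace Ω] {α γ β : Type*}
    [MeasurableSpace α] [StandardBorelSpace α] [Nonempty α]
    [MeasurableSpace γ] [StandardBorelSpace γ] [Nonempty γ] [MeasurableSpace β]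
    (U : Ω → α) (W : Ω → γ) (V : Ω → β) (P : Measure Ω) [IsFiniteMeasure P] : ℝ≥0∞ :=
  klDiv (P.map fun ω => (V ω, U ω, W ω))
    ((P.map V) ⊗ₘ ((condDistrib U V P) ×ₖ (condDistrib W V P)))

section Processes

variable {𝒳 𝒴 : ℕ → Type*}
  [∀ t, MeasurableSpace (𝒳 t)] [∀ t, MeasurableSpace (𝒴 t)]

/-- Directed information `I(X^n → Y^n) = ∑_{i=0}^n I(X^i ; Y_i | Y^{i-1})`. -/
def directedInfo [MeasurableSpace Ω]
    [∀ t, StandardBorelSpace (𝒳 t)] [∀ t, StandardBorelSpace (𝒴 t)]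
    [∀ t, Nonempty (𝒳 t)] [∀ t, Nonempty (𝒴 t)]
    (X : (t : ℕ) → Ω → 𝒳 t) (Y : (t : ℕ) → Ω → 𝒴 t) (n : ℕ)
    (P : Measure Ω) [IsFiniteMeasure P] : ℝ≥0∞ :=
  ∑ i ∈ Finset.range (n + 1), condMutualInfo (path X (i + 1)) (Y i) (path Y i) P

/-- Reverse directed information `I(X^n ← Y^n) = ∑_{i=0}^n I(Y^{i-1} ; X_i | X^{i-1})`. -/
def reverseDirectedInfo [MeasurableSpace Ω]
    [∀ t, StandardBorelSpace (𝒳 t)] [∀ t, StandardBorelSpace (𝒴 t)]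
    [∀ t, Nonempty (𝒳 t)] [∀ t, Nonempty (𝒴 t)]
    (X : (t : ℕ) → Ω → 𝒳 t) (Y : (t : ℕ) → Ω → 𝒴 t) (n : ℕ)
    (P : Measure Ω) [IsFiniteMeasure P] : ℝ≥0∞ :=
  ∑ i ∈ Finset.range (n + 1), condMutualInfo (path Y i) (X i) (path X i) P

lemma measurable_init (m : ℕ) :
    Measurable (fun x : Path 𝒳 (m + 1) => (fun j : Fin m => x j.castSucc : Path 𝒳 m)) :=
  measurable_pi_lambda _ fun j => measurable_pi_apply j.castSucc

lemma measurable_snoc (m : ℕ) :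
    Measurable (fun p : Path 𝒴 m × 𝒴 m =>
      (Fin.snoc (α := fun j : Fin (m + 1) => 𝒴 j) p.1 p.2 : Path 𝒴 (m + 1))) := by
  refine measurable_pi_lambda _ fun j => ?_
  refine Fin.lastCases ?_ (fun j => ?_) j
  · simpa using measurable_snd
  · simp only [Fin.snoc_castSucc]
    exact (measurable_pi_apply j).comp measurable_fst

/-- The causal product `⊗_{i=0}^{m-1} q_i(dy_i ; y^{i-1}, x^i)` of the kernels `q_i`, a kernel from
`x^{m-1}` to `y^{m-1}`, built one factor at a time:
`(⊗_{i=0}^{m} q_i)(dy^m ; x^m) = (⊗_{i=0}^{m-1} q_i)(dy^{m-1} ; x^{m-1}) q_m(dy_m ; y^{m-1}, x^m)`. -/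
def causalProd (q : (i : ℕ) → Kernel (Path 𝒴 i × Path 𝒳 (i + 1)) (𝒴 i)) :
    (m : ℕ) → Kernel (Path 𝒳 m) (Path 𝒴 m)
  | 0 => Kernel.deterministic (fun _ (j : Fin 0) => j.elim0) measurable_const
  | m + 1 =>
    (((causalProd q m).comap (fun (x : Path 𝒳 (m + 1)) (j : Fin m) => x j.castSucc)
        (measurable_init m)) ⊗ₖ
      ((q m).comap (fun p : Path 𝒳 (m + 1) × Path 𝒴 m => (p.2, p.1)) measurable_swap)).map
      (fun p : Path 𝒴 m × 𝒴 m =>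
        (Fin.snoc (α := fun j : Fin (m + 1) => 𝒴 j) p.1 p.2 : Path 𝒴 (m + 1)))

lemma isMarkovKernel_causalProd (q : (i : ℕ) → Kernel (Path 𝒴 i × Path 𝒳 (i + 1)) (𝒴 i))
    [∀ i, IsMarkovKernel (q i)] (m : ℕ) : IsMarkovKernel (causalProd q m) := by
  induction m with
  | zero => unfold causalProd; infer_instance
  | succ m ih =>
    unfold causalProd
    exact Kernel.IsMarkovKernel.map _ (measurable_snoc m)

/-- The reconstruction kernel `q_{0,n}(dy^n ; x^n)` is a causal product
`⊗_{i=0}^n q_i(dy_i ; y^{i-1}, x^i)` of stochastic kernels, for `μ`-almost every `x^n`. -/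
def IsCausalProduct (n : ℕ) (μ : Measure (Path 𝒳 (n + 1)))
    (q : Kernel (Path 𝒳 (n + 1)) (Path 𝒴 (n + 1))) : Prop :=
  ∃ r : (i : ℕ) → Kernel (Path 𝒴 i × Path 𝒳 (i + 1)) (𝒴 i),
    (∀ i, IsMarkovKernel (r i)) ∧ ∀ᵐ x ∂μ, q x = causalProd r (n + 1) x

end Processes

end

end CausalRD

open CausalRD

namespace CausalRD

/-! ### Composition of measures with kernels; invariance of relative entropy. -/

section Kernels

variable {α β γ δ : Type*} [MeasurableSpace α] [MeasurableSpace β] [MeasurableSpace γ]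
  [MeasurableSpace δ]

/-! The proof has two independent halves.

Information: expanding `I(X^n ; Y^n)` by the chain rule `mutualInfo_prodMk`, alternately in a letter
of `Y` and a letter of `X`, gives the conservation law `I(X^n ; Y^n) = I(X^n → Y^n) + I(X^n ← Y^n)`.
So a vanishing reverse term gives equality of the other two, and conversely when the directed
information is finite and can be cancelled. A relative entropy of probability measures is zero only
if they agree, so the reverse term vanishes exactly when each `Y^i ↔ X^i ↔ X_{i+1}` is Markov.

Causality: `U ↔ f Z ↔ g Z` is Markov when the law of `U` given `Z` is a kernel in `f Z` alone, and
conversely if `(f Z, g Z)` determines `Z` (`isMarkovChain_of_map_eq_compProd_comap`,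
`IsMarkovChain.map_eq_compProd_comap`). Integrating the last letters of `Y` out of a causal product
leaves a causal product, from which both families of Markov chains are read off. Conversely, either
family lets the conditional laws `causalKernel` rebuild the joint law letter by letter. -/

lemma map_compProd_comap (ρ : Measure δ) [SFinite ρ] {φ : δ → β} (hφ : Measurable φ)
    (κ : Kernel β α) [IsSFiniteKernel κ] :
    (ρ ⊗ₘ κ.comap φ hφ).map (fun p => (φ p.1, p.2)) = (ρ.map φ) ⊗ₘ κ := by
  ext s hs
  have hm : Measurable (fun p : δ × α => (φ p.1, p.2)) := by fun_prop
  rw [Measure.map_apply hm hs, Measure.compProd_apply (hm hs), Measure.compProd_apply hs,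
    lintegral_map (Kernel.measurable_kernel_prodMk_left hs) hφ]
  rfl

lemma map_assoc_compProd_prod (ρ : Measure β) [SFinite ρ] (κ : Kernel β α) [IsSFiniteKernel κ]
    (η : Kernel β γ) [IsSFiniteKernel η] :
    (ρ ⊗ₘ (κ ×ₖ η)).map (fun p => ((p.1, p.2.1), p.2.2)) =
      (ρ ⊗ₘ κ) ⊗ₘ η.comap Prod.fst measurable_fst := by
  refine Measure.ext_of_lintegral _ fun f hf => ?_
  rw [lintegral_map hf (by fun_prop), Measure.lintegral_compProd (by fun_prop),
    Measure.lintegral_compProd hf, Measure.lintegral_compProd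
      (hf.lintegral_kernel_prod_right' (κ := η.comap Prod.fst measurable_fst))]
  refine lintegral_congr fun v => ?_
  rw [Kernel.prod_apply, lintegral_prod _ (by fun_prop)]
  rfl

lemma map_prod_compProd (ν : Measure α) [SFinite ν] (ρ : Measure β) [SFinite ρ]
    (η : Kernel β γ) [IsSFiniteKernel η] :
    (ν.prod (ρ ⊗ₘ η)).map (fun p => ((p.2.1, p.1), p.2.2)) =
      (ρ.prod ν) ⊗ₘ η.comap Prod.fst measurable_fst := by
  refine Measure.ext_of_lintegral _ fun f hf => ?_
  rw [lintegral_map hf (by fun_prop), lintegral_prod_symm _ (by fun_prop),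
    Measure.lintegral_compProd (by fun_prop), Measure.lintegral_compProd hf,
    lintegral_prod _ (hf.lintegral_kernel_prod_right'
      (κ := η.comap Prod.fst measurable_fst)).aemeasurable]
  refine lintegral_congr fun v => ?_
  rw [lintegral_lintegral_swap (by fun_prop)]
  rfl

lemma klDiv_map_measurableEquiv (e : α ≃ᵐ β) (μ ν : Measure α) [IsFiniteMeasure μ]
    [IsFiniteMeasure ν] : klDiv (μ.map e) (ν.map e) = klDiv μ ν := by
  refine le_antisymm (klDiv_map_le μ ν e.measurable) ?_
  simpa [Measure.map_map e.symm.measurable e.measurable] using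
    klDiv_map_le (μ.map e) (ν.map e) e.symm.measurable

end Kernels

/-! ### Markov chains as identities between joint laws. -/

section MarkovChain

variable {Ω : Type*} [MeasurableSpace Ω] {P : Measure Ω}
  {α β γ δ : Type*} [MeasurableSpace α] [MeasurableSpace β] [MeasurableSpace γ]
  [MeasurableSpace δ] {U : Ω → α} {V : Ω → β} {W : Ω → γ} {Z : Ω → δ} {f : δ → β} {g : δ → γ}

lemma IsMarkovChain.symm (h : IsMarkovChain U V W P) : IsMarkovChain W V U P := by
  intro A B hA hB
  rw [Set.inter_comm]
  filter_upwards [h B A hB hA] with ω hω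
  rw [hω, mul_comm]

lemma map_comp_eq_compProd_of_map_eq [SFinite P] (hU : Measurable U) (hZ : Measurable Z) (hf : Measurable f)
    {κ : Kernel β α} [IsSFiniteKernel κ]
    (h : P.map (fun ω => (Z ω, U ω)) = (P.map Z) ⊗ₘ κ.comap f hf) :
    P.map (fun ω => (f (Z ω), U ω)) = (P.map fun ω => f (Z ω)) ⊗ₘ κ := by
  have := map_compProd_comap (P.map Z) hf κ
  rw [← h, Measure.map_map (by fun_prop) (by fun_prop), Measure.map_map hf hZ] at this
  exact this

variable [IsProbabilityMeasure P] [StandardBorelSpace α] [Nonempty α] [StandardBorelSpace γ] [Nonempty γ]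

lemma isMarkovChain_iff_condDistrib_ae_eq (hU : Measurable U) (hV : Measurable V)
    (hW : Measurable W) :
    IsMarkovChain U V W P ↔
      ∀ (A : Set α) (B : Set γ), MeasurableSet A → MeasurableSet B →
        ∀ᵐ ω ∂P, condDistrib (fun ω => (U ω, W ω)) V P (V ω) (A ×ˢ B) =
          condDistrib U V P (V ω) A * condDistrib W V P (V ω) B := by
  refine forall₄_congr fun A B hA hB => ?_
  have h1 := condDistrib_ae_eq_condExp (μ := P) hV (hU.prodMk hW) (hA.prod hB)
  have h2 := condDistrib_ae_eq_condExp (μ := P) hV hU hA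
  have h3 := condDistrib_ae_eq_condExp (μ := P) hV hW hB
  rw [Set.mk_preimage_prod] at h1
  refine Filter.eventually_congr ?_
  filter_upwards [h1, h2, h3] with ω h1 h2 h3
  rw [← h1, ← h2, ← h3, measureReal_def, measureReal_def, measureReal_def, ← ENNReal.toReal_mul,
    ENNReal.toReal_eq_toReal_iff' (measure_ne_top _ _)
      (ENNReal.mul_ne_top (measure_ne_top _ _) (measure_ne_top _ _))]

/-- Measures on a triple product are determined by boxes, so the exceptional null sets may depend on
`A` and `B`. Conversely, almost sure uniqueness of the kernel gives one null set for all `A` and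
`B`. -/
lemma isMarkovChain_iff_map_eq (hU : Measurable U) (hV : Measurable V) (hW : Measurable W) :
    IsMarkovChain U V W P ↔
      P.map (fun ω => (V ω, U ω, W ω)) =
        (P.map V) ⊗ₘ ((condDistrib U V P) ×ₖ (condDistrib W V P)) := by
  rw [isMarkovChain_iff_condDistrib_ae_eq hU hV hW,
    ← compProd_map_condDistrib (X := V) (hU.prodMk hW).aemeasurable]
  constructor
  · intro h
    rw [Measure.ext_prod₃_iff]
    intro C A B hC hA hB
    rw [Measure.compProd_apply_prod hC (hA.prod hB), Measure.compProd_apply_prod hC (hA.prod hB)]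
    refine lintegral_congr_ae (ae_restrict_of_ae ?_)
    refine (ae_map_iff hV.aemeasurable (measurableSet_eq_fun
      (Kernel.measurable_coe _ (hA.prod hB)) (Kernel.measurable_coe _ (hA.prod hB)))).2 ?_
    filter_upwards [h A B hA hB] with ω hω
    rw [hω, Kernel.prod_apply_prod]
  · intro h A B hA hB
    have := ae_of_ae_map hV.aemeasurable (Kernel.ae_eq_of_compProd_eq h)
    filter_upwards [this] with ω hω
    rw [hω, Kernel.prod_apply_prod]

/-- Turns conditional independence into its asymmetric form: the law of `W` given `(V, U)` ignores
`U`. -/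
lemma map_prodMk_prodMk_eq_iff (hU : Measurable U) (hV : Measurable V) (hW : Measurable W) :
    P.map (fun ω => (V ω, U ω, W ω)) =
        (P.map V) ⊗ₘ ((condDistrib U V P) ×ₖ (condDistrib W V P)) ↔
      P.map (fun ω => ((V ω, U ω), W ω)) =
        (P.map fun ω => (V ω, U ω)) ⊗ₘ (condDistrib W V P).comap Prod.fst measurable_fst := by
  rw [← compProd_map_condDistrib (X := V) hU.aemeasurable, ← map_assoc_compProd_prod]
  have : P.map (fun ω => ((V ω, U ω), W ω)) =
      (P.map fun ω => (V ω, U ω, W ω)).map (fun p => ((p.1, p.2.1), p.2.2)) := by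
    rw [Measure.map_map (by fun_prop) (by fun_prop)]; rfl
  rw [this]
  exact (MeasurableEquiv.map_measurableEquiv_injective
    (MeasurableEquiv.prodAssoc (α := β) (β := α) (γ := γ)).symm).eq_iff.symm

lemma isMarkovChain_iff_condMutualInfo_eq_zero (hU : Measurable U) (hV : Measurable V)
    (hW : Measurable W) : condMutualInfo U W V P = 0 ↔ IsMarkovChain U V W P := by
  have := Measure.isProbabilityMeasure_map (μ := P) hV.aemeasurable
  have := Measure.isProbabilityMeasure_map (μ := P) (hV.prodMk (hU.prodMk hW)).aemeasurable
  rw [condMutualInfo, klDiv_eq_zero_iff, isMarkovChain_iff_map_eq hU hV hW]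

/-- If `U` depends on `Z` only through `f Z`, then `U ↔ f Z ↔ g Z` is a Markov chain. -/
lemma isMarkovChain_of_map_eq_compProd_comap (hU : Measurable U) (hZ : Measurable Z)
    (hf : Measurable f) (hg : Measurable g) {κ : Kernel β α} [IsFiniteKernel κ]
    (h : P.map (fun ω => (Z ω, U ω)) = (P.map Z) ⊗ₘ κ.comap f hf) :
    IsMarkovChain U (fun ω => f (Z ω)) (fun ω => g (Z ω)) P := by
  have hfZ : Measurable (fun ω => f (Z ω)) := hf.comp hZ
  have hgZ : Measurable (fun ω => g (Z ω)) := hg.comp hZ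
  refine IsMarkovChain.symm ?_
  rw [isMarkovChain_iff_map_eq hgZ hfZ hU,
    map_prodMk_prodMk_eq_iff hgZ hfZ hU]
  have h1 := map_comp_eq_compProd_of_map_eq hU hZ hf h
  have h2 := condDistrib_ae_eq_of_measure_eq_compProd _ hU.aemeasurable h1
  have h3 := map_comp_eq_compProd_of_map_eq hU hZ (hf.prodMk hg)
    (κ := κ.comap Prod.fst measurable_fst) h
  rw [h3]
  refine Measure.compProd_congr ?_
  -- The almost sure equality `h2` lives on the law of `f Z`; seeing that law as a marginal lifts it
  -- to the law of the pair.
  have h4 : P.map (fun ω => f (Z ω)) = (P.map fun ω => (f (Z ω), g (Z ω))).map Prod.fst := by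
    rw [Measure.map_map (by fun_prop) (by fun_prop)]; rfl
  rw [h4] at h2
  filter_upwards [ae_of_ae_map measurable_fst.aemeasurable h2] with p hp
  rw [Kernel.comap_apply, Kernel.comap_apply, hp]

/-- If `U ↔ f Z ↔ g Z` is a Markov chain and `Z` is a function of `(f Z, g Z)`, then the law of
`U` given `Z` is the law of `U` given `f Z`. -/
lemma IsMarkovChain.map_eq_compProd_comap
    (hM : IsMarkovChain U (fun ω => f (Z ω)) (fun ω => g (Z ω)) P)
    (hU : Measurable U) (hZ : Measurable Z) (hf : Measurable f) (hg : Measurable g)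
    {r : β × γ → δ} (hr : Measurable r) (hrZ : ∀ z, r (f z, g z) = z) (hfr : ∀ p, f (r p) = p.1)
    {κ : Kernel β α} [IsFiniteKernel κ]
    (h : P.map (fun ω => (f (Z ω), U ω)) = (P.map fun ω => f (Z ω)) ⊗ₘ κ) :
    P.map (fun ω => (Z ω, U ω)) = (P.map Z) ⊗ₘ κ.comap f hf := by
  have hfZ : Measurable (fun ω => f (Z ω)) := hf.comp hZ
  have hgZ : Measurable (fun ω => g (Z ω)) := hg.comp hZ
  replace hM := hM.symm
  rw [isMarkovChain_iff_map_eq hgZ hfZ hU,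
    map_prodMk_prodMk_eq_iff hgZ hfZ hU] at hM
  have h2 := condDistrib_ae_eq_of_measure_eq_compProd _ hU.aemeasurable h
  have h4 : P.map (fun ω => f (Z ω)) = (P.map fun ω => (f (Z ω), g (Z ω))).map Prod.fst := by
    rw [Measure.map_map (by fun_prop) (by fun_prop)]; rfl
  rw [h4] at h2
  -- Writing the kernel as a pullback along `r` allows the identity to be pushed forward by `r`,
  -- which recovers `Z`.
  have h5 : P.map (fun ω => ((f (Z ω), g (Z ω)), U ω)) =
      (P.map fun ω => (f (Z ω), g (Z ω))) ⊗ₘ (κ.comap f hf).comap r hr := by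
    rw [hM]
    refine Measure.compProd_congr ?_
    filter_upwards [ae_of_ae_map measurable_fst.aemeasurable h2] with p hp
    rw [Kernel.comap_apply, Kernel.comap_apply, Kernel.comap_apply, hp, hfr]
  simpa only [hrZ] using map_comp_eq_compProd_of_map_eq hU (Z := fun ω => (f (Z ω), g (Z ω)))
    (by fun_prop) hr h5

/-- A one-point variable is a function of `V`. This covers the boundary cases: the trivial `Y^{-1}`
and the empty future block. -/
lemma isMarkovChain_of_subsingleton [Subsingleton γ] (hU : Measurable U) (hV : Measurable V)
    (W : Ω → γ) : IsMarkovChain U V W P := by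
  have : W = fun ω => (fun _ : β => Classical.arbitrary γ) (V ω) := Subsingleton.elim _ _
  rw [this]
  exact isMarkovChain_of_map_eq_compProd_comap (Z := V) (f := id) hU hV measurable_id
    measurable_const (κ := condDistrib U V P) (compProd_map_condDistrib hU.aemeasurable).symm

end MarkovChain

/-! ### Symmetry and chain rule for mutual information. -/

section MutualInfo

variable {Ω : Type*} [MeasurableSpace Ω] {P : Measure Ω} [IsProbabilityMeasure P]
  {α β γ δ : Type*} [MeasurableSpace α] [MeasurableSpace β] [MeasurableSpace γ]
  [MeasurableSpace δ] {U : Ω → α} {V : Ω → β} {W : Ω → γ}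

lemma mutualInfo_comm (hU : Measurable U) (hV : Measurable V) :
    mutualInfo U V P = mutualInfo V U P := by
  rw [mutualInfo, mutualInfo, ← klDiv_map_measurableEquiv MeasurableEquiv.prodComm]
  congr 1
  · rw [Measure.map_map (by fun_prop) (by fun_prop)]; rfl
  · exact Measure.prod_swap

lemma mutualInfo_comp_measurableEquiv (hU : Measurable U) (hV : Measurable V) (e : β ≃ᵐ δ) :
    mutualInfo U (fun ω => e (V ω)) P = mutualInfo U V P := by
  rw [mutualInfo, mutualInfo,
    ← klDiv_map_measurableEquiv ((MeasurableEquiv.refl α).prodCongr e)]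
  congr 1
  · rw [Measure.map_map (by fun_prop) (by fun_prop)]; rfl
  · have h := Measure.map_prod_map (P.map U) (P.map V) measurable_id e.measurable
    rw [Measure.map_id, Measure.map_map e.measurable hV] at h
    exact h

lemma condMutualInfo_eq_klDiv [StandardBorelSpace α] [Nonempty α] [StandardBorelSpace γ]
    [Nonempty γ] (hU : Measurable U) (hV : Measurable V) (hW : Measurable W) :
    condMutualInfo U W V P = klDiv (P.map fun ω => ((V ω, U ω), W ω))
      ((P.map fun ω => (V ω, U ω)) ⊗ₘ (condDistrib W V P).comap Prod.fst measurable_fst) := by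
  rw [condMutualInfo, ← compProd_map_condDistrib (X := V) hU.aemeasurable,
    ← map_assoc_compProd_prod, ← klDiv_map_measurableEquiv MeasurableEquiv.prodAssoc.symm]
  congr 1
  rw [Measure.map_map (by fun_prop) (by fun_prop)]; rfl

/-- Chain rule `I(U ; (V, W)) = I(U ; V) + I(U ; W | V)`. -/
lemma mutualInfo_prodMk [StandardBorelSpace α] [Nonempty α] [StandardBorelSpace γ]
    [Nonempty γ] (hU : Measurable U) (hV : Measurable V) (hW : Measurable W) :
    mutualInfo U (fun ω => (V ω, W ω)) P = mutualInfo U V P + condMutualInfo U W V P := by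
  let e : α × β × γ ≃ᵐ (β × α) × γ :=
    { toFun := fun p => ((p.2.1, p.1), p.2.2)
      invFun := fun p => (p.1.2, p.1.1, p.2)
      left_inv := fun _ => rfl
      right_inv := fun _ => rfl
      measurable_toFun := by dsimp; fun_prop
      measurable_invFun := by dsimp; fun_prop }
  have h1 : (P.map fun ω => (U ω, V ω, W ω)).map e = P.map fun ω => ((V ω, U ω), W ω) := by
    rw [Measure.map_map (by fun_prop) (by fun_prop)]; rfl
  have h2 : ((P.map U).prod (P.map fun ω => (V ω, W ω))).map e =
      ((P.map V).prod (P.map U)) ⊗ₘ (condDistrib W V P).comap Prod.fst measurable_fst := by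
    rw [← compProd_map_condDistrib (X := V) hW.aemeasurable]
    exact map_prod_compProd _ _ _
  rw [mutualInfo_comm hU hV, condMutualInfo_eq_klDiv hU hV hW, mutualInfo, mutualInfo,
    ← klDiv_map_measurableEquiv e, h1, h2,
    ← compProd_map_condDistrib (X := fun ω => (V ω, U ω)) hW.aemeasurable]
  -- Both laws are now compositions over `(V, U)`: `P_{V,U} ⊗ P_{W|V,U}` against `(P_V × P_U) ⊗
  -- P_{W|V}`. The base contributes `I(V ; U)`, the kernels `I(U ; W | V)`.
  exact klDiv_compProd_eq_add _ _ _ _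

end MutualInfo

/-! ### Cutting and joining strings. -/

section Paths

variable {𝒵 : ℕ → Type*}

/-- The first `m` entries of a string of length `M`. -/
def truncate {m M : ℕ} (h : m ≤ M) (z : Path 𝒵 M) : Path 𝒵 m := fun j => z (j.castLE h)

/-- The block `(z_{i+1}, …, z_n)` of a string `z^n`. -/
def tailBlock (i n : ℕ) (z : Path 𝒵 (n + 1)) : (j : Finset.Ioc i n) → 𝒵 j :=
  fun j => z ⟨j, Nat.lt_succ_of_le (Finset.mem_Ioc.1 j.2).2⟩

/-- The string `z^n` with initial segment `z^i` and remaining block `(z_{i+1}, …, z_n)`. -/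
def glue (i n : ℕ) (p : Path 𝒵 (i + 1) × ((j : Finset.Ioc i n) → 𝒵 j)) : Path 𝒵 (n + 1) :=
  fun j => if h : (j : ℕ) < i + 1 then p.1 ⟨j, h⟩
    else p.2 ⟨j, Finset.mem_Ioc.2 ⟨by omega, Nat.le_of_lt_succ j.2⟩⟩

lemma glue_truncate_tailBlock {i n : ℕ} (h : i + 1 ≤ n + 1) (z : Path 𝒵 (n + 1)) :
    glue i n (truncate h z, tailBlock i n z) = z := by
  funext j
  unfold glue
  split_ifs <;> rfl

lemma truncate_glue {i n : ℕ} (h : i + 1 ≤ n + 1)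
    (p : Path 𝒵 (i + 1) × ((j : Finset.Ioc i n) → 𝒵 j)) : truncate h (glue i n p) = p.1 := by
  funext j
  exact dif_pos j.2

variable [∀ t, MeasurableSpace (𝒵 t)]

lemma measurable_truncate {m M : ℕ} (h : m ≤ M) : Measurable (truncate (𝒵 := 𝒵) h) :=
  measurable_pi_lambda _ fun j => measurable_pi_apply (j.castLE h)

/-- A string of length `m + 1` is a string of length `m` followed by one more letter. -/
def snocEquiv (𝒵 : ℕ → Type*) [∀ t, MeasurableSpace (𝒵 t)] (m : ℕ) :
    Path 𝒵 m × 𝒵 m ≃ᵐ Path 𝒵 (m + 1) where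
  toFun p := Fin.snoc (α := fun j : Fin (m + 1) => 𝒵 j) p.1 p.2
  invFun z := (truncate m.le_succ z, z (Fin.last m))
  left_inv p := by
    refine Prod.ext (funext fun j => ?_) ?_
    · exact Fin.snoc_castSucc (α := fun j : Fin (m + 1) => 𝒵 j) p.2 p.1 j
    · exact Fin.snoc_last (α := fun j : Fin (m + 1) => 𝒵 j) p.2 p.1
  right_inv z := Fin.snoc_init_self (α := fun j : Fin (m + 1) => 𝒵 j) z
  measurable_toFun := measurable_snoc m
  measurable_invFun := (measurable_truncate _).prodMk (measurable_pi_apply (Fin.last m))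

variable {Ω : Type*} {Z : (t : ℕ) → Ω → 𝒵 t}

lemma snocEquiv_path (m : ℕ) (ω : Ω) :
    snocEquiv 𝒵 m (path Z m ω, Z m ω) = path Z (m + 1) ω :=
  (snocEquiv 𝒵 m).apply_symm_apply (path Z (m + 1) ω)

variable [MeasurableSpace Ω]

lemma measurable_path (hZ : ∀ t, Measurable (Z t)) (m : ℕ) : Measurable (path Z m) :=
  measurable_pi_lambda _ fun j => hZ j

lemma measurable_tailBlock (i n : ℕ) : Measurable (tailBlock (𝒵 := 𝒵) i n) :=
  measurable_pi_lambda _ fun _ => measurable_pi_apply _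

lemma measurable_glue (i n : ℕ) : Measurable (glue (𝒵 := 𝒵) i n) := by
  refine measurable_pi_lambda _ fun j => ?_
  unfold glue
  split_ifs with h
  · exact (measurable_pi_apply (⟨j, h⟩ : Fin (i + 1))).comp measurable_fst
  · exact (measurable_pi_apply (⟨j, _⟩ : Finset.Ioc i n)).comp measurable_snd

end Paths

/-! ### Conservation of information. -/

section Information

lemma mutualInfo_path_zero {𝒴 : ℕ → Type*} [∀ t, MeasurableSpace (𝒴 t)]
    {Ω : Type*} [MeasurableSpace Ω] {P : Measure Ω} [IsProbabilityMeasure P]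
    {Y : (t : ℕ) → Ω → 𝒴 t} {α : Type*} [MeasurableSpace α] {U : Ω → α} (hU : Measurable U) (hY : ∀ t, Measurable (Y t)) :
    mutualInfo U (path Y 0) P = 0 := by
  have := Measure.isProbabilityMeasure_map (μ := P) hU.aemeasurable
  have := Measure.isProbabilityMeasure_map (μ := P) (measurable_path hY 0).aemeasurable
  have := Measure.isProbabilityMeasure_map (μ := P)
    (hU.prodMk (measurable_path hY 0)).aemeasurable
  have h : path Y 0 = fun _ (j : Fin 0) => j.elim0 := Subsingleton.elim _ _
  rw [mutualInfo, klDiv_eq_zero_iff, h, Measure.map_const, measure_univ, one_smul,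
    Measure.prod_dirac, Measure.map_map (by fun_prop) hU]
  rfl

variable {𝒳 𝒴 : ℕ → Type*}
  [∀ t, MeasurableSpace (𝒳 t)] [∀ t, StandardBorelSpace (𝒳 t)] [∀ t, Nonempty (𝒳 t)]
  [∀ t, MeasurableSpace (𝒴 t)] [∀ t, StandardBorelSpace (𝒴 t)] [∀ t, Nonempty (𝒴 t)]
  {Ω : Type*} [MeasurableSpace Ω] {P : Measure Ω} [IsProbabilityMeasure P]
  {X : (t : ℕ) → Ω → 𝒳 t} {Y : (t : ℕ) → Ω → 𝒴 t}

lemma mutualInfo_path_succ (hY : ∀ t, Measurable (Y t)) {α : Type*} [MeasurableSpace α]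
    [StandardBorelSpace α] [Nonempty α] {U : Ω → α} (hU : Measurable U) (m : ℕ) :
    mutualInfo U (path Y (m + 1)) P =
      mutualInfo U (path Y m) P + condMutualInfo U (Y m) (path Y m) P := by
  rw [← mutualInfo_prodMk hU (measurable_path hY m) (hY m),
    ← mutualInfo_comp_measurableEquiv hU ((measurable_path hY m).prodMk (hY m))
      (snocEquiv 𝒴 m)]
  simp only [snocEquiv_path]

/-- Conservation of information:
`I(X^n ; Y^n) = I(X^n → Y^n) + I(X^n ← Y^n)`. -/
theorem mutualInfo_eq_directedInfo_add_reverseDirectedInfo (hX : ∀ t, Measurable (X t))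
    (hY : ∀ t, Measurable (Y t)) (n : ℕ) :
    mutualInfo (path X (n + 1)) (path Y (n + 1)) P =
      directedInfo X Y n P + reverseDirectedInfo X Y n P := by
  rw [directedInfo, reverseDirectedInfo, ← Finset.sum_add_distrib]
  -- Induction on the length can then start from empty strings, where both sides are zero.
  generalize n + 1 = m
  induction m with
  | zero => simpa using mutualInfo_path_zero (measurable_path hX 0) hY
  | succ m ih =>
    -- `Y` loses its last letter against the longer `X` string, giving the directed term; then `X`
    -- loses its last letter against the shorter `Y` string, giving the reverse term.
    rw [Finset.sum_range_succ, ← ih, mutualInfo_path_succ hY (measurable_path hX _),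
      mutualInfo_comm (measurable_path hX _) (measurable_path hY _),
      mutualInfo_path_succ hX (measurable_path hY _),
      mutualInfo_comm (measurable_path hX _) (measurable_path hY _)]
    ring

/-- The reverse directed information vanishes iff `Y^i ↔ X^i ↔ X_{i+1}` for all `i < n`. -/
theorem reverseDirectedInfo_eq_zero_iff (hX : ∀ t, Measurable (X t))
    (hY : ∀ t, Measurable (Y t)) (n : ℕ) :
    reverseDirectedInfo X Y n P = 0 ↔
      ∀ i < n, IsMarkovChain (path Y (i + 1)) (path X (i + 1)) (X (i + 1)) P := by
  have h (i : ℕ) : condMutualInfo (path Y i) (X i) (path X i) P = 0 ↔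
      IsMarkovChain (path Y i) (path X i) (X i) P :=
    isMarkovChain_iff_condMutualInfo_eq_zero (measurable_path hY i) (measurable_path hX i) (hX i)
  simp only [reverseDirectedInfo, Finset.sum_eq_zero_iff, Finset.mem_range, h]
  refine ⟨fun H i hi => H (i + 1) (by omega), fun H i hi => ?_⟩
  cases i with
  -- The term `i = 0` involves only the trivial `Y^{-1}`, hence the index shift between the two
  -- sides.
  | zero => exact (isMarkovChain_of_subsingleton (hX 0) (measurable_path hX 0) _).symm
  | succ i => exact H i (by omega)

end Information

/-! ### Recursion for causal products. -/

section Causal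

variable {𝒳 𝒴 : ℕ → Type*} [∀ t, MeasurableSpace (𝒳 t)] [∀ t, MeasurableSpace (𝒴 t)]

/-- Composing the causal product of the first `m` kernels with the kernel `q_m`. -/
lemma map_compProd_causalProd (q : (i : ℕ) → Kernel (Path 𝒴 i × Path 𝒳 (i + 1)) (𝒴 i))
    [∀ i, IsMarkovKernel (q i)] {m M : ℕ} (h : m + 1 ≤ M) (ρ : Measure (Path 𝒳 M)) [SFinite ρ] :
    ((ρ ⊗ₘ (causalProd q m).comap (truncate (m.le_succ.trans h)) (measurable_truncate _)) ⊗ₘ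
        (q m).comap (fun p : Path 𝒳 M × Path 𝒴 m => (p.2, truncate h p.1))
          (measurable_snd.prodMk ((measurable_truncate h).comp measurable_fst))).map
      (fun p => (p.1.1, snocEquiv 𝒴 m (p.1.2, p.2))) =
    ρ ⊗ₘ (causalProd q (m + 1)).comap (truncate h) (measurable_truncate h) := by
  have := isMarkovKernel_causalProd q
  have hs : Measurable (fun p : (Path 𝒳 M × Path 𝒴 m) × 𝒴 m =>
      (p.1.1, snocEquiv 𝒴 m (p.1.2, p.2))) := by fun_prop
  refine Measure.ext_of_lintegral _ fun f hf => ?_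
  have hfs : Measurable (fun p : (Path 𝒳 M × Path 𝒴 m) × 𝒴 m =>
      f (p.1.1, snocEquiv 𝒴 m (p.1.2, p.2))) := hf.comp hs
  rw [lintegral_map hf hs, Measure.lintegral_compProd hfs,
    Measure.lintegral_compProd hfs.lintegral_kernel_prod_right',
    Measure.lintegral_compProd hf]
  refine lintegral_congr fun x => ?_
  have hfx : Measurable fun y => f (x, y) := hf.comp measurable_prodMk_left
  rw [Kernel.comap_apply _ (measurable_truncate h), causalProd,
    Kernel.map_apply _ (measurable_snoc m), lintegral_map hfx (measurable_snoc m)]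
  have hfs' : Measurable fun p : Path 𝒴 m × 𝒴 m =>
      f (x, Fin.snoc (α := fun j : Fin (m + 1) => 𝒴 j) p.1 p.2) := hfx.comp (measurable_snoc m)
  rw [Kernel.lintegral_compProd _ _ _ hfs']
  rfl

end Causal

/-- With a one-point second factor the first marginal carries everything; this starts the inductions
at the empty `Y` string. -/
lemma measure_prod_ext_of_fst_eq {β γ : Type*} [MeasurableSpace β] [MeasurableSpace γ]
    [Nonempty γ] [Subsingleton γ] {ρ ρ' : Measure (β × γ)} (h : ρ.fst = ρ'.fst) : ρ = ρ' := by
  have key (ν : Measure (β × γ)) :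
      ν = ν.fst.map fun x => (x, Classical.arbitrary γ) := by
    rw [Measure.fst, Measure.map_map (by fun_prop) measurable_fst]
    conv_lhs => rw [← Measure.map_id (μ := ν)]
    congr 1
    ext p : 1
    exact Prod.ext rfl (Subsingleton.elim _ _)
  rw [key ρ, key ρ', h]

/-! ### Causal products and the Markov chains of the joint law. -/

section Causal

variable {𝒳 𝒴 : ℕ → Type*} [∀ t, MeasurableSpace (𝒳 t)] [∀ t, MeasurableSpace (𝒴 t)]

lemma map_compProd_causalProd_symm (q : (i : ℕ) → Kernel (Path 𝒴 i × Path 𝒳 (i + 1)) (𝒴 i))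
    [∀ i, IsMarkovKernel (q i)] {m M : ℕ} (h : m + 1 ≤ M) (ρ : Measure (Path 𝒳 M)) [SFinite ρ] :
    (ρ ⊗ₘ (causalProd q (m + 1)).comap (truncate h) (measurable_truncate h)).map
      (fun p => ((p.1, ((snocEquiv 𝒴 m).symm p.2).1), ((snocEquiv 𝒴 m).symm p.2).2)) =
    (ρ ⊗ₘ (causalProd q m).comap (truncate (m.le_succ.trans h)) (measurable_truncate _)) ⊗ₘ
        (q m).comap (fun p : Path 𝒳 M × Path 𝒴 m => (p.2, truncate h p.1))
          (measurable_snd.prodMk ((measurable_truncate h).comp measurable_fst)) := by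
  rw [← map_compProd_causalProd q h ρ, Measure.map_map (by fun_prop) (by fun_prop)]
  convert Measure.map_id
  ext p : 1
  simp

lemma map_prodMk_path_zero {Ω : Type*} [MeasurableSpace Ω] {P : Measure Ω} [SFinite P]
    {Y : (t : ℕ) → Ω → 𝒴 t} {β : Type*} [MeasurableSpace β] {V : Ω → β}
    (hY : ∀ t, Measurable (Y t)) (κ : Kernel β (Path 𝒴 0)) [IsMarkovKernel κ] :
    P.map (fun ω => (V ω, path Y 0 ω)) = P.map V ⊗ₘ κ := by
  have : Nonempty (Path 𝒴 0) := ⟨fun j => j.elim0⟩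
  refine measure_prod_ext_of_fst_eq ?_
  rw [Measure.fst_compProd, Measure.fst_map_prodMk (measurable_path hY 0)]

/-- If `(X^n, Y^n)` has law `μ(dx^n) q(dy^n ; x^n)`, then `q` is a causal product iff the law of
`(X^n, Y^n)` is the composition of `μ` with a causal product. -/
lemma isCausalProduct_iff [∀ t, StandardBorelSpace (𝒴 t)] {Ω : Type*} [MeasurableSpace Ω]
    {P : Measure Ω} {X : (t : ℕ) → Ω → 𝒳 t} {Y : (t : ℕ) → Ω → 𝒴 t} (hY : ∀ t, Measurable (Y t)) {n : ℕ}
    {μ : Measure (Path 𝒳 (n + 1))} [IsProbabilityMeasure μ]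
    {q : Kernel (Path 𝒳 (n + 1)) (Path 𝒴 (n + 1))} [IsMarkovKernel q]
    (hq : (P.map fun ω => (path X (n + 1) ω, path Y (n + 1) ω)) = μ ⊗ₘ q) :
    IsCausalProduct n μ q ↔
      ∃ r : (i : ℕ) → Kernel (Path 𝒴 i × Path 𝒳 (i + 1)) (𝒴 i), (∀ i, IsMarkovKernel (r i)) ∧
        P.map (fun ω => (path X (n + 1) ω, path Y (n + 1) ω)) =
          P.map (path X (n + 1)) ⊗ₘ causalProd r (n + 1) := by
  have hμ : P.map (path X (n + 1)) = μ := by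
    have := congrArg Measure.fst hq
    rwa [Measure.fst_compProd, Measure.fst_map_prodMk (measurable_path hY _)] at this
  rw [hμ, hq]
  refine exists_congr fun r => and_congr_right fun hr => ?_
  have := isMarkovKernel_causalProd r
  exact ⟨fun h => Measure.compProd_congr h, fun h => Kernel.ae_eq_of_compProd_eq h⟩

variable {Ω : Type*} [MeasurableSpace Ω] {P : Measure Ω} [IsProbabilityMeasure P]
  {X : (t : ℕ) → Ω → 𝒳 t} {Y : (t : ℕ) → Ω → 𝒴 t}
  {q : (i : ℕ) → Kernel (Path 𝒴 i × Path 𝒳 (i + 1)) (𝒴 i)} [∀ i, IsMarkovKernel (q i)]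

lemma map_prodMk_path_of_causalProd_succ (hX : ∀ t, Measurable (X t))
    (hY : ∀ t, Measurable (Y t)) {m M : ℕ} (h : m + 1 ≤ M)
    (hm : P.map (fun ω => (path X M ω, path Y (m + 1) ω)) =
      P.map (path X M) ⊗ₘ (causalProd q (m + 1)).comap (truncate h) (measurable_truncate h)) :
    P.map (fun ω => ((path X M ω, path Y m ω), Y m ω)) =
      (P.map (path X M) ⊗ₘ (causalProd q m).comap (truncate (m.le_succ.trans h))
        (measurable_truncate _)) ⊗ₘ
        (q m).comap (fun p : Path 𝒳 M × Path 𝒴 m => (p.2, truncate h p.1))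
          (measurable_snd.prodMk ((measurable_truncate h).comp measurable_fst)) := by
  rw [← map_compProd_causalProd_symm q h, ← hm, Measure.map_map (by fun_prop)
    ((measurable_path hX M).prodMk (measurable_path hY _))]
  rfl

/-- The last factor `q m` has mass one, so it disappears when `Y m` is integrated out, while the
whole string `X^{M-1}` is kept. -/
lemma map_path_prodMk_path_of_causalProd_succ (hX : ∀ t, Measurable (X t))
    (hY : ∀ t, Measurable (Y t)) {m M : ℕ} (h : m + 1 ≤ M)
    (hm : P.map (fun ω => (path X M ω, path Y (m + 1) ω)) =
      P.map (path X M) ⊗ₘ (causalProd q (m + 1)).comap (truncate h) (measurable_truncate h)) :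
    P.map (fun ω => (path X M ω, path Y m ω)) =
      P.map (path X M) ⊗ₘ (causalProd q m).comap (truncate (m.le_succ.trans h))
        (measurable_truncate _) := by
  have := congrArg Measure.fst (map_prodMk_path_of_causalProd_succ hX hY h hm)
  rwa [Measure.fst_compProd, Measure.fst_map_prodMk (hY m)] at this

lemma map_path_prodMk_path_of_causalProd_of_le (hX : ∀ t, Measurable (X t))
    (hY : ∀ t, Measurable (Y t)) {m k M : ℕ} (hmk : m ≤ k) (h : k ≤ M)
    (hk : P.map (fun ω => (path X M ω, path Y k ω)) =
      P.map (path X M) ⊗ₘ (causalProd q k).comap (truncate h) (measurable_truncate h)) :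
    P.map (fun ω => (path X M ω, path Y m ω)) =
      P.map (path X M) ⊗ₘ (causalProd q m).comap (truncate (hmk.trans h))
        (measurable_truncate _) := by
  induction hmk with
  | refl => exact hk
  | step hmk ih =>
    exact ih (Nat.le_of_succ_le h) (map_path_prodMk_path_of_causalProd_succ hX hY h hk)

lemma map_path_succ_of_causalProd (hX : ∀ t, Measurable (X t))
    (hY : ∀ t, Measurable (Y t)) {m M : ℕ} (h : m + 1 ≤ M)
    (hm : P.map (fun ω => (path X M ω, path Y m ω)) =
      P.map (path X M) ⊗ₘ (causalProd q m).comap (truncate (m.le_succ.trans h))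
        (measurable_truncate _))
    (hq : P.map (fun ω => ((path X M ω, path Y m ω), Y m ω)) =
      P.map (fun ω => (path X M ω, path Y m ω)) ⊗ₘ
        (q m).comap (fun p : Path 𝒳 M × Path 𝒴 m => (p.2, truncate h p.1))
          (measurable_snd.prodMk ((measurable_truncate h).comp measurable_fst))) :
    P.map (fun ω => (path X M ω, path Y (m + 1) ω)) =
      P.map (path X M) ⊗ₘ (causalProd q (m + 1)).comap (truncate h) (measurable_truncate h) := by
  have hXM := measurable_path hX M
  have hYm := measurable_path hY m
  have := hY m
  rw [← map_compProd_causalProd q h, ← hm, ← hq, Measure.map_map (by fun_prop) (by fun_prop)]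
  simp only [Function.comp_def, snocEquiv_path]

variable [∀ t, StandardBorelSpace (𝒴 t)] [∀ t, Nonempty (𝒴 t)]

variable (X Y P) in
/-- The conditional law of `Y_i` given `(Y^{i-1}, X^i)`. -/
noncomputable def causalKernel (i : ℕ) : Kernel (Path 𝒴 i × Path 𝒳 (i + 1)) (𝒴 i) :=
  condDistrib (Y i) (fun ω => (path Y i ω, path X (i + 1) ω)) P

instance (i : ℕ) : IsMarkovKernel (causalKernel P X Y i) := by
  unfold causalKernel; infer_instance

lemma map_eq_compProd_causalKernel (hX : ∀ t, Measurable (X t)) (hY : ∀ t, Measurable (Y t))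
    (m : ℕ) :
    P.map (fun ω => ((path X (m + 1) ω, path Y m ω), Y m ω)) =
      P.map (fun ω => (path X (m + 1) ω, path Y m ω)) ⊗ₘ
        (causalKernel P X Y m).comap Prod.swap measurable_swap :=
  map_comp_eq_compProd_of_map_eq (Z := fun ω => (path Y m ω, path X (m + 1) ω)) (f := Prod.swap)
    (hY m) ((measurable_path hY m).prodMk (measurable_path hX _)) measurable_swap
    (κ := (causalKernel P X Y m).comap Prod.swap measurable_swap)
    (compProd_map_condDistrib (hY m).aemeasurable).symm

variable [∀ t, StandardBorelSpace (𝒳 t)] [∀ t, Nonempty (𝒳 t)]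

/-- Once the later letters of `Y` are integrated out, the kernel for `Y^i` sees only `x^i`;
forgetting the letters of `X` after `X_{i+1}` does not change it. -/
lemma isMarkovChain_path_of_causalProd (hX : ∀ t, Measurable (X t))
    (hY : ∀ t, Measurable (Y t)) {n : ℕ}
    (h : P.map (fun ω => (path X (n + 1) ω, path Y (n + 1) ω)) =
      P.map (path X (n + 1)) ⊗ₘ causalProd q (n + 1)) {i : ℕ} (hi : i < n) :
    IsMarkovChain (path Y (i + 1)) (path X (i + 1)) (X (i + 1)) P := by
  have := isMarkovKernel_causalProd q
  have h1 := map_path_prodMk_path_of_causalProd_of_le (q := q) hX hY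
    (show i + 1 ≤ n + 1 by omega) le_rfl h
  have h2 := map_comp_eq_compProd_of_map_eq (f := truncate (show i + 2 ≤ n + 1 by omega))
    (measurable_path hY (i + 1)) (measurable_path hX (n + 1)) (measurable_truncate _)
    (κ := (causalProd q (i + 1)).comap (truncate (i + 1).le_succ) (measurable_truncate _)) h1
  exact isMarkovChain_of_map_eq_compProd_comap (Z := path X (i + 2))
    (g := fun x => x (Fin.last (i + 1))) (measurable_path hY (i + 1))
    (measurable_path hX (i + 2)) (measurable_truncate (i + 1).le_succ)
    (measurable_pi_apply (Fin.last (i + 1))) h2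

/-- Given all of `X^n` and `Y^{i-1}`, the letter `Y_i` is drawn from `q i`, which reads no letter of
`X` beyond `x_i`. -/
lemma isMarkovChain_future_of_causalProd (hX : ∀ t, Measurable (X t))
    (hY : ∀ t, Measurable (Y t)) {n : ℕ}
    (h : P.map (fun ω => (path X (n + 1) ω, path Y (n + 1) ω)) =
      P.map (path X (n + 1)) ⊗ₘ causalProd q (n + 1)) {i : ℕ} (hi : i < n) :
    IsMarkovChain (Y i) (fun ω => (path X (i + 1) ω, path Y i ω)) (future X i n) P := by
  have hi' : i + 1 ≤ n + 1 := by omega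
  have h1 := map_path_prodMk_path_of_causalProd_of_le (q := q) hX hY hi' le_rfl h
  have h2 := map_prodMk_path_of_causalProd_succ hX hY hi' h1
  rw [← map_path_prodMk_path_of_causalProd_succ hX hY hi' h1] at h2
  exact isMarkovChain_of_map_eq_compProd_comap
    (Z := fun ω => (path X (n + 1) ω, path Y i ω))
    (f := fun p => (truncate hi' p.1, p.2)) (g := fun p => tailBlock i n p.1)
    (hY i) ((measurable_path hX _).prodMk (measurable_path hY _))
    (((measurable_truncate hi').comp measurable_fst).prodMk measurable_snd)
    ((measurable_tailBlock i n).comp measurable_fst)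
    (κ := (q i).comap Prod.swap measurable_swap) h2

/-- Both strings grow together. The Markov chain adjoins `X m` without altering the kernel of the
`Y` string so far; `Y m` is then adjoined by its own conditional law. -/
lemma map_eq_compProd_causalProd_of_isMarkovChain_path (hX : ∀ t, Measurable (X t))
    (hY : ∀ t, Measurable (Y t)) {n : ℕ}
    (h : ∀ i < n, IsMarkovChain (path Y (i + 1)) (path X (i + 1)) (X (i + 1)) P) :
    P.map (fun ω => (path X (n + 1) ω, path Y (n + 1) ω)) =
      P.map (path X (n + 1)) ⊗ₘ causalProd (causalKernel P X Y) (n + 1) := by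
  have := isMarkovKernel_causalProd (causalKernel P X Y)
  suffices H : ∀ m ≤ n + 1, P.map (fun ω => (path X m ω, path Y m ω)) =
      P.map (path X m) ⊗ₘ causalProd (causalKernel P X Y) m from H _ le_rfl
  intro m hm
  induction m with
  | zero => exact map_prodMk_path_zero hY _
  | succ m ih =>
    refine map_path_succ_of_causalProd hX hY le_rfl ?_ (map_eq_compProd_causalKernel hX hY m)
    have hM : IsMarkovChain (path Y m) (path X m) (X m) P := by
      cases m with
      | zero => exact (isMarkovChain_of_subsingleton (hX 0) (measurable_path hX 0) _).symm
      | succ i => exact h i (by omega)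
    exact IsMarkovChain.map_eq_compProd_comap (Z := path X (m + 1))
      (g := fun x => x (Fin.last m)) hM (measurable_path hY m)
      (measurable_path hX (m + 1)) (measurable_truncate m.le_succ)
      (measurable_pi_apply (Fin.last m)) (snocEquiv 𝒳 m).measurable
      (fun z => (snocEquiv 𝒳 m).apply_symm_apply z)
      (fun p => congrArg Prod.fst ((snocEquiv 𝒳 m).symm_apply_apply p)) (ih (by omega))

/-- The full string `X^n` stays fixed and only `Y` grows: by the Markov chain, conditioning on the
future of `X` as well leaves `causalKernel` the conditional law of `Y m`. -/
lemma map_eq_compProd_causalProd_of_isMarkovChain_future (hX : ∀ t, Measurable (X t))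
    (hY : ∀ t, Measurable (Y t)) {n : ℕ}
    (h : ∀ i < n,
      IsMarkovChain (Y i) (fun ω => (path X (i + 1) ω, path Y i ω)) (future X i n) P) :
    P.map (fun ω => (path X (n + 1) ω, path Y (n + 1) ω)) =
      P.map (path X (n + 1)) ⊗ₘ causalProd (causalKernel P X Y) (n + 1) := by
  have := isMarkovKernel_causalProd (causalKernel P X Y)
  suffices H : ∀ m (hm : m ≤ n + 1), P.map (fun ω => (path X (n + 1) ω, path Y m ω)) =
      P.map (path X (n + 1)) ⊗ₘ (causalProd (causalKernel P X Y) m).comap (truncate hm)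
        (measurable_truncate hm) from H _ le_rfl
  intro m hm
  induction m with
  | zero => exact map_prodMk_path_zero hY _
  | succ m ih =>
    refine map_path_succ_of_causalProd hX hY hm (ih _) ?_
    have hM : IsMarkovChain (Y m) (fun ω => (path X (m + 1) ω, path Y m ω)) (future X m n) P := by
      rcases (Nat.le_of_succ_le_succ hm).lt_or_eq with hmn | rfl
      · exact h m hmn
      -- For the last letter, `m = n`, no hypothesis is available, but the future block is empty.
      · have : IsEmpty (Finset.Ioc m m) := Finset.isEmpty_coe_sort.2 (Finset.Ioc_self m)
        exact isMarkovChain_of_subsingleton (hY m)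
          ((measurable_path hX _).prodMk (measurable_path hY _)) _
    refine IsMarkovChain.map_eq_compProd_comap
      (Z := fun ω => (path X (n + 1) ω, path Y m ω))
      (f := fun p => (truncate hm p.1, p.2)) (g := fun p => tailBlock m n p.1)
      (r := fun p => (glue m n (p.1.1, p.2), p.1.2)) hM
      (hY m) ((measurable_path hX _).prodMk (measurable_path hY _))
      (((measurable_truncate hm).comp measurable_fst).prodMk measurable_snd)
      ((measurable_tailBlock m n).comp measurable_fst)
      (((measurable_glue m n).comp (by fun_prop)).prodMk (by fun_prop))
      (fun z => Prod.ext (glue_truncate_tailBlock hm z.1) rfl)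
      (fun p => Prod.ext (truncate_glue hm _) rfl) (map_eq_compProd_causalKernel hX hY m)

end Causal

end CausalRD

theorem lemma2p1 {Ω : Type*} [MeasurableSpace Ω] (P : Measure Ω) [IsProbabilityMeasure P]
    {𝒳 𝒴 : ℕ → Type*}
    [∀ t, TopologicalSpace (𝒳 t)] [∀ t, PolishSpace (𝒳 t)] [∀ t, Nonempty (𝒳 t)]
    [∀ t, MeasurableSpace (𝒳 t)] [∀ t, BorelSpace (𝒳 t)]
    [∀ t, TopologicalSpace (𝒴 t)] [∀ t, PolishSpace (𝒴 t)] [∀ t, Nonempty (𝒴 t)]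
    [∀ t, MeasurableSpace (𝒴 t)] [∀ t, BorelSpace (𝒴 t)]
    (X : (t : ℕ) → Ω → 𝒳 t) (hX : ∀ t, Measurable (X t))
    (Y : (t : ℕ) → Ω → 𝒴 t) (hY : ∀ t, Measurable (Y t))
    (n : ℕ)
    (μ : Measure (Path 𝒳 (n + 1))) [IsProbabilityMeasure μ]
    (q : Kernel (Path 𝒳 (n + 1)) (Path 𝒴 (n + 1))) [IsMarkovKernel q]
    (hq : (P.map fun ω => (path X (n + 1) ω, path Y (n + 1) ω)) = μ ⊗ₘ q) :
    List.TFAE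
      [IsCausalProduct n μ q,
        ∀ i < n, IsMarkovChain (Y i) (fun ω => (path X (i + 1) ω, path Y i ω)) (future X i n) P,
        reverseDirectedInfo X Y n P = 0,
        ∀ i < n, IsMarkovChain (path Y (i + 1)) (path X (i + 1)) (X (i + 1)) P] ∧
    (reverseDirectedInfo X Y n P = 0 →
      mutualInfo (path X (n + 1)) (path Y (n + 1)) P = directedInfo X Y n P) ∧
    (directedInfo X Y n P ≠ ∞ →
      List.TFAE
        [IsCausalProduct n μ q,
          ∀ i < n, IsMarkovChain (Y i) (fun ω => (path X (i + 1) ω, path Y i ω)) (future X i n) P,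
          mutualInfo (path X (n + 1)) (path Y (n + 1)) P = directedInfo X Y n P,
          reverseDirectedInfo X Y n P = 0,
          ∀ i < n, IsMarkovChain (path Y (i + 1)) (path X (i + 1)) (X (i + 1)) P]) := by
  have hcons := mutualInfo_eq_directedInfo_add_reverseDirectedInfo (P := P) hX hY n
  have h12 : IsCausalProduct n μ q ↔ ∀ i < n,
      IsMarkovChain (Y i) (fun ω => (path X (i + 1) ω, path Y i ω)) (future X i n) P := by
    rw [isCausalProduct_iff hY hq]
    exact ⟨fun ⟨_, _, h⟩ _ hi => isMarkovChain_future_of_causalProd hX hY h hi,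
      fun h => ⟨_, inferInstance, map_eq_compProd_causalProd_of_isMarkovChain_future hX hY h⟩⟩
  have h15 : IsCausalProduct n μ q ↔
      ∀ i < n, IsMarkovChain (path Y (i + 1)) (path X (i + 1)) (X (i + 1)) P := by
    rw [isCausalProduct_iff hY hq]
    exact ⟨fun ⟨_, _, h⟩ _ hi => isMarkovChain_path_of_causalProd hX hY h hi,
      fun h => ⟨_, inferInstance, map_eq_compProd_causalProd_of_isMarkovChain_path hX hY h⟩⟩
  have h45 := reverseDirectedInfo_eq_zero_iff (P := P) hX hY n
  refine ⟨?_, fun h => by rw [hcons, h, add_zero], fun hfin => ?_⟩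
  · tfae_have 1 ↔ 2 := h12
    tfae_have 1 ↔ 4 := h15
    tfae_have 3 ↔ 4 := h45
    tfae_finish
  · have h34 : mutualInfo (path X (n + 1)) (path Y (n + 1)) P = directedInfo X Y n P ↔
        reverseDirectedInfo X Y n P = 0 := by
      rw [hcons]
      -- Finiteness enters only here: in `[0, ∞]` only a finite summand can be cancelled.
      exact ⟨fun h => (ENNReal.add_right_inj hfin).1 (h.trans (add_zero _).symm),
        fun h => by rw [h, add_zero]⟩
    tfae_have 1 ↔ 2 := h12
    tfae_have 1 ↔ 5 := h15
    tfae_have 3 ↔ 4 := h34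
    tfae_have 4 ↔ 5 := h45
    tfae_finish
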